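/- Let $\mathbb K\subset\mathbb C$ be a field, let $\mathbf f=(f_1,\dots,f_N)$ with $f_k\in\mathbb K[x_1,\dots,x_n]$, and let $\xi\in\mathbb C^n$ be an isolated root of $\mathbf f$, i.e. a root that is the only root of $\mathbf f$ in some Zariski open neighbourhood of $\xi$. **Multiplicity and nil-index.** Let $\mathbf g$ be a finite system in $\mathbb K[x_1,\dots,x_n]$ with isolated root $\xi$, and let $I$ be the ideal of $\mathbb C[x_1,\dots,x_n]$ that it generates. The multiplicity is $\delta_\xi(\mathbf g)=\dim_{\mathbb C}\mathbb C[x_1,\dots,x_n]/Q$, where $Q$ is the primary component of $I$ at $\xi$. Let an element $\Lambda=\sum_\beta a_\beta\partial^\beta$ of $\mathbb C[\partial_1,\dots,\partial_n]$ act on polynomials by $\Lambda(p)=\sum_\beta a_\beta\,(\partial^\beta p)(\xi)$; its order is its total degree in $\partial_1,\dots,\partial_n$. Let $\mathscr D=\{\Lambda : \Lambda(p)=0\text{ for all }p\in I\}$ and let $\mathscr D_t$ be the set of elements of $\mathscr D$ of order at most $t$. The nil-index $o_\xi(\mathbf g)$ is the smallest $t\ge 0$ with $\mathscr D_{t+1}=\mathscr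 D_t$. **Deflated system.** Let $J_{\mathbf f}=[\partial_j f_k]$ be the Jacobian matrix, let $r=\operatorname{rank}J_{\mathbf f}(\xi)$, assume $r<n$, and put $c=n-r$. Reorder the rows and columns of $J_{\mathbf f}$ in any way such that $$J_{\mathbf f}=\begin{pmatrix}A&B\\ C&D\end{pmatrix}$$ with $A$ of size $r\times r$ and $\operatorname{rank}A(\xi)=r$. The $c$ columns of the polynomial matrix $$\det(A)\begin{pmatrix}-A^{-1}B\\ \mathrm{Id}\end{pmatrix}$$ (the identity matrix if $r=0$) are the coefficient vectors of differential operators $\Lambda_i=\sum_{j=1}^n\lambda_{i,j}(\mathbf x)\,\partial_j$, $i=1,\dots,c$. For a nonempty set $\mathbf i\subset\{1,\dots,c\}$, the $\mathbf i$-deflated system $\mathbf f^{(1)}$ of order $1$ consists of $f_1,\dots,f_N$ together with all $\Lambda_i(f_k)$, $i\in\mathbf i$, $1\le k\le N$. **Claim.** The point $\xi$ is still an isolated root of $\mathbf f^{(1)}$, and $$\delta_\xi(\mathbf f^{(1)})\ge 1,\qquad o_\xi(\mathbf f^{(1)})<o_\xi(\mathbf f),\qquad \delta_\xi(\mathbf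 f^{(1)})<\delta_\xi(\mathbf f).$$ -/

import Mathlib

open MvPolynomial

noncomputable section

namespace Deflation

/-! ### Roots, ideals and multiplicity of a polynomial system

A system is a family `f : ι → K[x₁, …, xₙ]`; `K` is a subfield of `ℂ`. -/

variable {K : Type*} [Field K] [Algebra K ℂ] {ι : Type*} {n : ℕ}

/-- `ξ` is a common zero of the system `f`. -/
def IsRoot (f : ι → MvPolynomial (Fin n) K) (ξ : Fin n → ℂ) : Prop :=
  ∀ k, aeval ξ (f k) = 0

/-- `ξ` is an isolated root of `f`: it is a root, and it is the only root of `f` in some Zariski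
open neighbourhood `{x | g x ≠ 0}` of `ξ`. -/
def IsIsolatedRoot (f : ι → MvPolynomial (Fin n) K) (ξ : Fin n → ℂ) : Prop :=
  IsRoot f ξ ∧ ∃ g : MvPolynomial (Fin n) ℂ, eval ξ g ≠ 0 ∧
    ∀ x : Fin n → ℂ, IsRoot f x → eval x g ≠ 0 → x = ξ

/-- The ideal of `ℂ[x₁, …, xₙ]` generated by the system `f`. -/
def systemIdeal (f : ι → MvPolynomial (Fin n) K) : Ideal (MvPolynomial (Fin n) ℂ) :=
  Ideal.span (Set.range fun k => MvPolynomial.map (algebraMap K ℂ) (f k))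

/-- The contraction to `ℂ[x]` of the extension of `I` to the local ring at `ξ`, that is, the set of
`p` with `g p ∈ I` for some `g` not vanishing at `ξ`. At an isolated zero `ξ` of `I` this is the
primary component of `I` at `ξ`. -/
def primaryComponent (I : Ideal (MvPolynomial (Fin n) ℂ)) (ξ : Fin n → ℂ) :
    Ideal (MvPolynomial (Fin n) ℂ) where
  carrier := {p | ∃ g, eval ξ g ≠ 0 ∧ g * p ∈ I}
  zero_mem' := ⟨1, by simp, by simp⟩
  add_mem' := by
    rintro p q ⟨g, hg, hp⟩ ⟨h, hh, hq⟩
    refine ⟨g * h, by simp [hg, hh], ?_⟩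
    have e : g * h * (p + q) = h * (g * p) + g * (h * q) := by ring
    rw [e]
    exact I.add_mem (I.mul_mem_left _ hp) (I.mul_mem_left _ hq)
  smul_mem' := by
    rintro c p ⟨g, hg, hp⟩
    refine ⟨g, hg, ?_⟩
    have e : g * (c • p) = c * (g * p) := by rw [smul_eq_mul]; ring
    rw [e]
    exact I.mul_mem_left _ hp

/-- The multiplicity `δ_ξ(f) = dim_ℂ ℂ[x] / Q`, with `Q` the primary component at `ξ` of the ideal
generated by `f`. -/
def multiplicity (f : ι → MvPolynomial (Fin n) K) (ξ : Fin n → ℂ) : ℕ :=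
  Module.finrank ℂ (MvPolynomial (Fin n) ℂ ⧸ primaryComponent (systemIdeal f) ξ)

/-! ### The inverse system and its nil-index -/

/-- The iterated partial derivative `∂^β = ∂₁^β₁ ⋯ ∂ₙ^βₙ`. -/
def iterPderiv (β : Fin n →₀ ℕ) : Module.End ℂ (MvPolynomial (Fin n) ℂ) :=
  (List.ofFn fun j : Fin n =>
    ((pderiv j).toLinearMap : Module.End ℂ (MvPolynomial (Fin n) ℂ)) ^ β j).prod

/-- An element `Λ = ∑ a_β ∂^β` of `ℂ[∂₁, …, ∂ₙ]`, seen as the functional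
`p ↦ ∑ a_β (∂^β p)(ξ)` on `ℂ[x₁, …, xₙ]`. The variables of the first polynomial ring are the
symbols `∂₁, …, ∂ₙ`. -/
def diffEval (ξ : Fin n → ℂ) :
    MvPolynomial (Fin n) ℂ →ₗ[ℂ] Module.Dual ℂ (MvPolynomial (Fin n) ℂ) :=
  (basisMonomials (Fin n) ℂ).constr ℂ fun β =>
    (aeval ξ : MvPolynomial (Fin n) ℂ →ₐ[ℂ] ℂ).toLinearMap ∘ₗ iterPderiv β

/-- The inverse system `𝒟 = I^⊥ ∩ ℂ[∂_ξ]` of `f` at `ξ`, where `I` is the ideal generated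
by `f`. -/
def inverseSystem (f : ι → MvPolynomial (Fin n) K) (ξ : Fin n → ℂ) :
    Submodule ℂ (MvPolynomial (Fin n) ℂ) :=
  ((systemIdeal f).restrictScalars ℂ).dualAnnihilator.comap (diffEval ξ)

/-- `𝒟_t`: the elements of the inverse system of order (total degree in the `∂_j`) at most `t`. -/
def inverseSystemLE (f : ι → MvPolynomial (Fin n) K) (ξ : Fin n → ℂ) (t : ℕ) :
    Submodule ℂ (MvPolynomial (Fin n) ℂ) :=
  inverseSystem f ξ ⊓ restrictTotalDegree (Fin n) ℂ t

/-- The nil-index `o_ξ(f)`: the smallest `t` with `𝒟_{t+1} = 𝒟_t`. -/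
def nilIndex (f : ι → MvPolynomial (Fin n) K) (ξ : Fin n → ℂ) : ℕ :=
  sInf {t | inverseSystemLE f ξ (t + 1) = inverseSystemLE f ξ t}

/-! ### The deflated system of order one -/

/-- The Jacobian matrix `[∂_j f_k]`, with polynomial entries. -/
def jacobian (f : ι → MvPolynomial (Fin n) K) : Matrix ι (Fin n) (MvPolynomial (Fin n) K) :=
  Matrix.of fun k j => pderiv j (f k)

/-- The value at the point `ξ` of a matrix of polynomials. -/
def evalMatrix {l m : Type*} (ξ : Fin n → ℂ) (M : Matrix l m (MvPolynomial (Fin n) K)) :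
    Matrix l m ℂ :=
  M.map (aeval ξ)

variable {r s c : ℕ}

/-- The upper left block `A` of the Jacobian matrix after the rows and columns are reordered by
`rows` and `cols`. -/
def blockA (f : ι → MvPolynomial (Fin n) K) (rows : Fin r ⊕ Fin s ≃ ι)
    (cols : Fin r ⊕ Fin c ≃ Fin n) : Matrix (Fin r) (Fin r) (MvPolynomial (Fin n) K) :=
  ((jacobian f).submatrix rows cols).toBlocks₁₁

/-- The upper right block `B` of the reordered Jacobian matrix. -/
def blockB (f : ι → MvPolynomial (Fin n) K) (rows : Fin r ⊕ Fin s ≃ ι)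
    (cols : Fin r ⊕ Fin c ≃ Fin n) : Matrix (Fin r) (Fin c) (MvPolynomial (Fin n) K) :=
  ((jacobian f).submatrix rows cols).toBlocks₁₂

/-- The matrix `det A • [-A⁻¹ B; Id]`, whose entries are polynomials because
`det A • A⁻¹` is the adjugate of `A`. -/
def kernelMatrix (f : ι → MvPolynomial (Fin n) K) (rows : Fin r ⊕ Fin s ≃ ι)
    (cols : Fin r ⊕ Fin c ≃ Fin n) :
    Matrix (Fin r ⊕ Fin c) (Fin c) (MvPolynomial (Fin n) K) :=
  Matrix.fromRows (-((blockA f rows cols).adjugate * blockB f rows cols))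
    ((blockA f rows cols).det • (1 : Matrix (Fin c) (Fin c) (MvPolynomial (Fin n) K)))

/-- The differential `Λ_i = ∑ⱼ λ_{i,j}(x) ∂_j` whose coefficients form the `i`-th column of
`kernelMatrix`, applied to the polynomial `p`. -/
def formalDifferential (f : ι → MvPolynomial (Fin n) K) (rows : Fin r ⊕ Fin s ≃ ι)
    (cols : Fin r ⊕ Fin c ≃ Fin n) (i : Fin c) (p : MvPolynomial (Fin n) K) :
    MvPolynomial (Fin n) K :=
  ∑ j : Fin n, kernelMatrix f rows cols (cols.symm j) i * pderiv j p

/-- The `S`-deflated system of order one of `f`: the polynomials `f_k` together with the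
`Λ_i(f_k)` for `i ∈ S`. -/
def deflatedSystem (f : ι → MvPolynomial (Fin n) K) (rows : Fin r ⊕ Fin s ≃ ι)
    (cols : Fin r ⊕ Fin c ≃ Fin n) (S : Finset (Fin c)) :
    ι ⊕ (S × ι) → MvPolynomial (Fin n) K :=
  Sum.elim f fun q => formalDifferential f rows cols q.1 (f q.2)

end Deflation

end

/-! Let `m` be the maximal ideal at `ξ`, and `Q ≤ Q'` the primary components of the original and
deflated ideals `I ≤ I'`. Each `Λ_i` maps `I` into `I'`, hence `Q` into `Q'`. For a suitable
coordinate `l = x_j - ξ_j`, the value of `Λ_i l` at `ξ` is `det A(ξ) ≠ 0`, so `Λ_i l` can be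
cancelled modulo `Q'`. The coefficients of `Λ_i` at `ξ` lie in the kernel of the Jacobian there, so
`ξ` remains a root.

Multiplicity: if `Q = Q'`, repeatedly applying `Λ_i` to `l ^ M ∈ Q` would give `1 ∈ Q`
(`primaryComponent_lt_of_derivation`). Nil-index: pairing operators with the monomials `(x - ξ)^γ`
shows that `o_ξ` is the least `t` with `m ^ (t + 1) ≤ Q` (`nilIndex_le_of_pow_le`,
`pow_nilIndex_succ_le`). Applying `Λ_i` to products `l ^ (j + 1) * q` turns this into `m ^ t ≤ Q'`
(`pointIdeal_pow_le_of_derivation`). -/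

namespace Deflation

/-! ### Primary components at a point and the effect of derivations on them. -/

section LocalAlgebra

variable {n : ℕ} {ξ : Fin n → ℂ}

/-- The maximal ideal of polynomials vanishing at `ξ`. -/
noncomputable def pointIdeal (ξ : Fin n → ℂ) : Ideal (MvPolynomial (Fin n) ℂ) :=
  RingHom.ker (eval ξ)

lemma mem_pointIdeal {p : MvPolynomial (Fin n) ℂ} : p ∈ pointIdeal ξ ↔ eval ξ p = 0 :=
  RingHom.mem_ker

lemma X_sub_C_mem_pointIdeal (j : Fin n) : X j - C (ξ j) ∈ pointIdeal ξ := by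
  simp [mem_pointIdeal]

/-- A polynomial not vanishing at `ξ` is invertible modulo every power of the maximal ideal. -/
lemma exists_one_sub_mul_mem_pow {g : MvPolynomial (Fin n) ℂ} (hg : eval ξ g ≠ 0) (k : ℕ) :
    ∃ h, 1 - h * g ∈ pointIdeal ξ ^ k := by
  -- Since `u` vanishes at `ξ`, the truncated geometric series in `u` inverts `1 - u` modulo the
  -- `k`-th power.
  set u : MvPolynomial (Fin n) ℂ := 1 - C (eval ξ g)⁻¹ * g with hu
  have hum : u ∈ pointIdeal ξ := by simp [mem_pointIdeal, hu, hg]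
  refine ⟨C (eval ξ g)⁻¹ * ∑ i ∈ Finset.range k, u ^ i, ?_⟩
  have e : 1 - C (eval ξ g)⁻¹ * (∑ i ∈ Finset.range k, u ^ i) * g = u ^ k := by
    have := mul_neg_geom_sum u k
    have h1 : 1 - u = C (eval ξ g)⁻¹ * g := by rw [hu]; ring
    rw [h1] at this
    linear_combination (-1 : MvPolynomial (Fin n) ℂ) * this
  rw [e]
  exact Ideal.pow_mem_pow hum k

lemma le_primaryComponent (I : Ideal (MvPolynomial (Fin n) ℂ)) : I ≤ primaryComponent I ξ :=
  fun p hp => ⟨1, by simp, by simpa using hp⟩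

lemma primaryComponent_mono {I J : Ideal (MvPolynomial (Fin n) ℂ)} (h : I ≤ J) :
    primaryComponent I ξ ≤ primaryComponent J ξ :=
  fun _ ⟨g, hg, hp⟩ => ⟨g, hg, h hp⟩

lemma mem_primaryComponent_of_mul_mem {I : Ideal (MvPolynomial (Fin n) ℂ)}
    {g p : MvPolynomial (Fin n) ℂ} (hg : eval ξ g ≠ 0) (h : g * p ∈ primaryComponent I ξ) :
    p ∈ primaryComponent I ξ := by
  obtain ⟨g', hg', hp⟩ := h
  exact ⟨g' * g, by simp [hg, hg'], by rwa [mul_assoc]⟩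

lemma primaryComponent_le_pointIdeal {I : Ideal (MvPolynomial (Fin n) ℂ)}
    (h : I ≤ pointIdeal ξ) : primaryComponent I ξ ≤ pointIdeal ξ := by
  rintro p ⟨g, hg, hp⟩
  have := mem_pointIdeal.1 (h hp)
  rw [map_mul] at this
  exact mem_pointIdeal.2 ((mul_eq_zero.1 this).resolve_left hg)

/-- A derivation lowers the order of vanishing at a point by at most one. -/
lemma derivation_mem_pow (D : Derivation ℂ (MvPolynomial (Fin n) ℂ) (MvPolynomial (Fin n) ℂ))
    (k : ℕ) {p : MvPolynomial (Fin n) ℂ} (hp : p ∈ pointIdeal ξ ^ (k + 1)) :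
    D p ∈ pointIdeal ξ ^ k := by
  induction k generalizing p with
  | zero => simp
  | succ k ih =>
    rw [pow_succ] at hp
    refine Submodule.mul_induction_on hp (fun a ha b hb => ?_) (fun a b ha hb => ?_)
    · rw [D.leibniz, smul_eq_mul, smul_eq_mul]
      refine Ideal.add_mem _ (Ideal.mul_mem_right _ _ ha) ?_
      rw [pow_succ']
      exact Ideal.mul_mem_mul hb (ih ha)
    · rw [map_add]
      exact Ideal.add_mem _ ha hb

lemma derivation_mem_of_span
    (D : Derivation ℂ (MvPolynomial (Fin n) ℂ) (MvPolynomial (Fin n) ℂ))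
    {s : Set (MvPolynomial (Fin n) ℂ)} {J : Ideal (MvPolynomial (Fin n) ℂ)}
    (hs : Ideal.span s ≤ J) (hD : ∀ p ∈ s, D p ∈ J) {p : MvPolynomial (Fin n) ℂ}
    (hp : p ∈ Ideal.span s) : D p ∈ J := by
  refine Submodule.span_induction hD (by simp) (fun a b _ _ ha hb => ?_)
    (fun a b hb h => ?_) hp
  · rw [map_add]
    exact J.add_mem ha hb
  · rw [smul_eq_mul, D.leibniz, smul_eq_mul, smul_eq_mul]
    exact J.add_mem (J.mul_mem_left _ h) (J.mul_mem_right _ (hs hb))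

/-- A derivation mapping `I` into `J ⊇ I` maps the primary component of `I` into that of `J`. -/
lemma derivation_mem_primaryComponent
    (D : Derivation ℂ (MvPolynomial (Fin n) ℂ) (MvPolynomial (Fin n) ℂ))
    {I J : Ideal (MvPolynomial (Fin n) ℂ)} (hIJ : I ≤ J) (hD : ∀ p ∈ I, D p ∈ J)
    {p : MvPolynomial (Fin n) ℂ} (hp : p ∈ primaryComponent I ξ) :
    D p ∈ primaryComponent J ξ := by
  have hpJ := primaryComponent_mono hIJ hp
  obtain ⟨g, hg, hgp⟩ := hp
  refine mem_primaryComponent_of_mul_mem hg ?_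
  have h := le_primaryComponent (ξ := ξ) J (hD _ hgp)
  rw [D.leibniz, smul_eq_mul, smul_eq_mul] at h
  exact (Ideal.add_mem_iff_left _ (Ideal.mul_mem_right _ _ hpJ)).1 h

variable {D : Derivation ℂ (MvPolynomial (Fin n) ℂ) (MvPolynomial (Fin n) ℂ)}
  {I J : Ideal (MvPolynomial (Fin n) ℂ)}

/-- If a derivation transversal to `ξ` maps `I` into `J`, then `J` has a strictly larger primary
component than `I`. -/
lemma primaryComponent_lt_of_derivation (hIJ : I ≤ J) (hD : ∀ p ∈ I, D p ∈ J)
    (hI : I ≤ pointIdeal ξ) {l : MvPolynomial (Fin n) ℂ} (hl : l ∈ pointIdeal ξ)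
    (hDl : eval ξ (D l) ≠ 0) {M : ℕ} (hM : pointIdeal ξ ^ M ≤ primaryComponent I ξ) :
    primaryComponent I ξ < primaryComponent J ξ := by
  refine lt_of_le_of_ne (primaryComponent_mono hIJ) fun h => ?_
  -- If the two components agree, `D` preserves them, so `l ^ (k + 1)` inside would force `l ^ k`
  -- inside, down to `1`.
  have key : ∀ k, l ^ k ∉ primaryComponent I ξ := by
    intro k
    induction k with
    | zero =>
      intro h1
      have := mem_pointIdeal.1 (primaryComponent_le_pointIdeal hI h1)
      simp at this
    | succ k ih =>
      intro h1
      apply ih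
      have h2 := derivation_mem_primaryComponent D hIJ hD h1
      rw [← h, D.leibniz_pow, Nat.add_sub_cancel, smul_eq_mul, ← Nat.cast_smul_eq_nsmul ℂ,
        smul_eq_C_mul] at h2
      refine mem_primaryComponent_of_mul_mem (g := C ((k + 1 : ℕ) : ℂ) * D l) ?_ ?_
      · simp only [map_mul, eval_C]
        exact mul_ne_zero (by exact_mod_cast k.succ_ne_zero) hDl
      · convert h2 using 1
        ring
  exact key M (hM (Ideal.pow_mem_pow hl M))

/-- If a derivation transversal to `ξ` maps `I` into `J`, then the local algebra of `J` has
smaller socle degree than that of `I`. -/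
lemma pointIdeal_pow_le_of_derivation (hIJ : I ≤ J) (hD : ∀ p ∈ I, D p ∈ J)
    {l : MvPolynomial (Fin n) ℂ} (hl : l ∈ pointIdeal ξ)
    (hDl : eval ξ (D l) ≠ 0) {t : ℕ} (ht : pointIdeal ξ ^ (t + 1) ≤ primaryComponent I ξ) :
    pointIdeal ξ ^ t ≤ primaryComponent J ξ := by
  -- Factors of `q` are traded for powers of `l`: `D (l ^ (j + 1) * q)` is `(j + 1) l ^ j (D l) q`
  -- plus `l ^ (j + 1) * D q`, and the latter is covered by the case of `k - 1`. The goal is `j =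
  -- 0`.
  have key : ∀ k j, j + k = t → ∀ q ∈ pointIdeal ξ ^ k, l ^ j * q ∈ primaryComponent J ξ := by
    intro k
    induction k with
    | zero =>
      intro j hj q _
      obtain rfl : j = t := by omega
      have hpow : l ^ (j + 1) ∈ primaryComponent I ξ := ht (Ideal.pow_mem_pow hl _)
      have h2 := derivation_mem_primaryComponent D hIJ hD hpow
      rw [D.leibniz_pow, Nat.add_sub_cancel, smul_eq_mul, ← Nat.cast_smul_eq_nsmul ℂ,
        smul_eq_C_mul] at h2
      refine Ideal.mul_mem_right _ _ ?_
      refine mem_primaryComponent_of_mul_mem (g := C ((j + 1 : ℕ) : ℂ) * D l) ?_ ?_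
      · simp only [map_mul, eval_C]
        exact mul_ne_zero (by exact_mod_cast j.succ_ne_zero) hDl
      · convert h2 using 1
        ring
    | succ k ih =>
      intro j hj q hq
      have hmem : l ^ (j + 1) * q ∈ primaryComponent I ξ := by
        refine ht ?_
        rw [← hj, show j + (k + 1) + 1 = (j + 1) + (k + 1) by ring, pow_add]
        exact Ideal.mul_mem_mul (Ideal.pow_mem_pow hl _) hq
      have h2 := derivation_mem_primaryComponent D hIJ hD hmem
      have h3 := ih (j + 1) (by omega) (D q) (derivation_mem_pow D k hq)
      rw [D.leibniz, smul_eq_mul, smul_eq_mul, Ideal.add_mem_iff_right _ h3, D.leibniz_pow,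
        Nat.add_sub_cancel, smul_eq_mul, ← Nat.cast_smul_eq_nsmul ℂ, smul_eq_C_mul] at h2
      refine mem_primaryComponent_of_mul_mem (g := C ((j + 1 : ℕ) : ℂ) * D l) ?_ ?_
      · simp only [map_mul, eval_C]
        exact mul_ne_zero (by exact_mod_cast j.succ_ne_zero) hDl
      · convert h2 using 1
        ring
  intro q hq
  simpa using key t 0 (by omega) q hq

/-- The quotient by an ideal containing a power of the maximal ideal of a point is finite
dimensional. -/
lemma finite_quotient_of_pow_le {Q : Ideal (MvPolynomial (Fin n) ℂ)} {M : ℕ}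
    (hM : pointIdeal ξ ^ M ≤ Q) : Module.Finite ℂ (MvPolynomial (Fin n) ℂ ⧸ Q) := by
  rw [Algebra.finite_iff_isIntegral_and_finiteType]
  refine ⟨⟨fun y => ?_⟩, inferInstance⟩
  obtain ⟨p, rfl⟩ := Ideal.Quotient.mk_surjective y
  -- This makes `(X - p(ξ)) ^ M` a monic equation for the class of `p`.
  have hp : (p - C (eval ξ p)) ^ M ∈ Q :=
    hM (Ideal.pow_mem_pow (by simp [mem_pointIdeal]) M)
  refine ⟨(Polynomial.X - Polynomial.C (eval ξ p)) ^ M,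
    (Polynomial.monic_X_sub_C _).pow M, ?_⟩
  rw [← Polynomial.aeval_def, map_pow, map_sub, Polynomial.aeval_X, Polynomial.aeval_C]
  exact (Ideal.Quotient.eq_zero_iff_mem (I := Q)).2 hp

lemma finrank_quotient_lt {P Q : Ideal (MvPolynomial (Fin n) ℂ)} (h : P < Q)
    [Module.Finite ℂ (MvPolynomial (Fin n) ℂ ⧸ P)] :
    Module.finrank ℂ (MvPolynomial (Fin n) ℂ ⧸ Q) <
      Module.finrank ℂ (MvPolynomial (Fin n) ℂ ⧸ P) := by
  let φ : (MvPolynomial (Fin n) ℂ ⧸ P) →ₐ[ℂ] (MvPolynomial (Fin n) ℂ ⧸ Q) :=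
    Ideal.Quotient.factorₐ ℂ h.le
  have hsurj : Function.Surjective φ.toLinearMap := Ideal.Quotient.factor_surjective h.le
  rw [← LinearMap.finrank_range_add_finrank_ker φ.toLinearMap,
    LinearMap.range_eq_top.2 hsurj, finrank_top]
  obtain ⟨p, hpQ, hpP⟩ := SetLike.exists_of_lt h
  have : 0 < Module.finrank ℂ (LinearMap.ker φ.toLinearMap) := by
    refine Module.finrank_pos_iff_exists_ne_zero.2 ⟨⟨Ideal.Quotient.mk P p, ?_⟩, ?_⟩
    · exact (Ideal.Quotient.eq_zero_iff_mem (I := Q)).2 hpQ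
    · intro h0
      exact hpP (Ideal.Quotient.eq_zero_iff_mem.1 (congrArg Subtype.val h0))
  omega

end LocalAlgebra

/-! ### The Nullstellensatz at an isolated root. -/

section Systems

variable {K : Type*} [Field K] [Algebra K ℂ] {ι : Type*} {n : ℕ}
  {f : ι → MvPolynomial (Fin n) K} {ξ : Fin n → ℂ}

lemma IsRoot.systemIdeal_le (h : IsRoot f ξ) : systemIdeal f ≤ pointIdeal ξ := by
  refine Ideal.span_le.2 ?_
  rintro _ ⟨k, rfl⟩
  rw [SetLike.mem_coe, mem_pointIdeal, eval_map, ← aeval_def]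
  exact h k

/-- Nullstellensatz: the primary component at an isolated root contains a power of the maximal
ideal. -/
lemma IsIsolatedRoot.exists_pow_le (h : IsIsolatedRoot f ξ) :
    ∃ M, pointIdeal ξ ^ M ≤ primaryComponent (systemIdeal f) ξ := by
  obtain ⟨-, g, hg, hiso⟩ := h
  refine Ideal.exists_pow_le_of_le_radical_of_fg (fun p hp => ?_)
    (IsNoetherian.noetherian (pointIdeal ξ))
  -- On the zero locus, `g` vanishes away from `ξ` and `p` vanishes at `ξ`.
  have hrad : g * p ∈ (systemIdeal f).radical := by
    rw [← vanishingIdeal_zeroLocus_eq_radical (K := ℂ), mem_vanishingIdeal_iff]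
    intro x hx
    have hxroot : IsRoot f x := fun k => by
      have := hx _ (Ideal.subset_span ⟨k, rfl⟩)
      rwa [aeval_map_algebraMap] at this
    by_cases hgx : eval x g = 0
    · simp [hgx]
    · obtain rfl := hiso x hxroot hgx
      simp [mem_pointIdeal.1 hp]
  obtain ⟨m, hm⟩ := hrad
  refine ⟨m, g ^ m, by simp [hg], ?_⟩
  rwa [← mul_pow]

end Systems

/-! ### Derivatives of the monomials centred at `ξ`. -/

section ShiftedMonomials

variable {n : ℕ} {ξ : Fin n → ℂ}

/-- The monomial `(x - ξ)^γ`. -/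
noncomputable def shiftedMonomial (ξ : Fin n → ℂ) (γ : Fin n → ℕ) : MvPolynomial (Fin n) ℂ :=
  ∏ i, (X i - C (ξ i)) ^ γ i

lemma shiftedMonomial_mem_pow (γ : Fin n → ℕ) :
    shiftedMonomial ξ γ ∈ pointIdeal ξ ^ ∑ i, γ i := by
  rw [shiftedMonomial, ← Finset.prod_pow_eq_pow_sum]
  exact Ideal.prod_mem_prod fun i _ => Ideal.pow_mem_pow (X_sub_C_mem_pointIdeal i) _

lemma eval_shiftedMonomial (γ : Fin n → ℕ) :
    eval ξ (shiftedMonomial ξ γ) = if γ = 0 then 1 else 0 := by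
  rw [shiftedMonomial, map_prod]
  split_ifs with h
  · simp [h]
  · obtain ⟨j, hj⟩ := Function.ne_iff.1 h
    exact Finset.prod_eq_zero (Finset.mem_univ j) (by simpa using hj)

/-- The truncated exponent `γ j - 1` is harmless: the coefficient is zero when `γ j = 0`. -/
lemma pderiv_shiftedMonomial (j : Fin n) (γ : Fin n → ℕ) :
    pderiv j (shiftedMonomial ξ γ) =
      (γ j : ℂ) • shiftedMonomial ξ (Function.update γ j (γ j - 1)) := by
  have hsplit : ∀ δ : Fin n → ℕ, shiftedMonomial ξ δ =
      (X j - C (ξ j)) ^ δ j * ∏ i ∈ Finset.univ.erase j, (X i - C (ξ i)) ^ δ i := fun δ =>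
    (Finset.mul_prod_erase _ _ (Finset.mem_univ j)).symm
  have hrest : pderiv j (∏ i ∈ Finset.univ.erase j, (X i - C (ξ i)) ^ γ i) = 0 := by
    refine Finset.prod_induction _ (fun p => pderiv j p = 0) ?_ (by simp) ?_
    · intro a b ha hb
      simp [ha, hb]
    · intro i hi
      have hij : i ≠ j := Finset.ne_of_mem_erase hi
      rw [Derivation.leibniz_pow]
      simp [pderiv_X_of_ne hij]
  have hupd : ∏ i ∈ Finset.univ.erase j, (X i - C (ξ i)) ^ Function.update γ j (γ j - 1) i =
      ∏ i ∈ Finset.univ.erase j, (X i - C (ξ i)) ^ γ i :=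
    Finset.prod_congr rfl fun i hi => by
      rw [Function.update_of_ne (Finset.ne_of_mem_erase hi)]
  rw [hsplit γ, hsplit (Function.update γ j (γ j - 1)), hupd, Derivation.leibniz, hrest,
    Derivation.leibniz_pow, Function.update_self, map_sub, pderiv_X_self, pderiv_C]
  simp only [smul_eq_mul, smul_eq_C_mul, ← Nat.cast_smul_eq_nsmul ℂ]
  ring

lemma pderiv_pow_shiftedMonomial (j : Fin n) (k : ℕ) (γ : Fin n → ℕ) :
    (((pderiv j).toLinearMap : Module.End ℂ (MvPolynomial (Fin n) ℂ)) ^ k)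
      (shiftedMonomial ξ γ) =
      ((γ j).descFactorial k : ℂ) • shiftedMonomial ξ (Function.update γ j (γ j - k)) := by
  induction k with
  | zero => simp
  | succ k ih =>
    rw [pow_succ', Module.End.mul_apply, ih, map_smul, Derivation.coeFn_coe,
      pderiv_shiftedMonomial, smul_smul, Function.update_idem,
      Function.update_self, Nat.descFactorial_succ, Nat.sub_sub]
    push_cast
    rw [mul_comm]

lemma list_prod_pderiv_shiftedMonomial (β γ : Fin n → ℕ) {l : List (Fin n)} (hl : l.Nodup) :
    (l.map fun j => ((pderiv j).toLinearMap :
      Module.End ℂ (MvPolynomial (Fin n) ℂ)) ^ β j).prod (shiftedMonomial ξ γ) =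
      ((l.map fun j => (γ j).descFactorial (β j)).prod : ℂ) •
        shiftedMonomial ξ (fun i => if i ∈ l then γ i - β i else γ i) := by
  induction l with
  | nil => simp
  | cons j l ih =>
    obtain ⟨hj, hl⟩ := List.nodup_cons.1 hl
    rw [List.map_cons, List.prod_cons, Module.End.mul_apply, ih hl, map_smul,
      pderiv_pow_shiftedMonomial, smul_smul, if_neg hj, List.map_cons, List.prod_cons]
    congr 1
    · push_cast
      rw [mul_comm]
    · congr 1
      ext i
      by_cases hij : i = j
      · subst hij
        simp
      · simp [hij]

/-- Up to factorials, the operators and the centred monomials are dual families, so coefficients of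
an operator can be read off. -/
lemma eval_iterPderiv_shiftedMonomial (β : Fin n →₀ ℕ) (γ : Fin n → ℕ) :
    eval ξ (iterPderiv β (shiftedMonomial ξ γ)) =
      if γ = β then ∏ i, ((β i).factorial : ℂ) else 0 := by
  have h := list_prod_pderiv_shiftedMonomial (ξ := ξ) β γ (List.nodup_finRange n)
  rw [← List.ofFn_eq_map, ← List.ofFn_eq_map, List.prod_ofFn] at h
  rw [iterPderiv, h, smul_eval, eval_shiftedMonomial]
  split_ifs with h1 h2 h2
  · subst h2
    simp [Nat.descFactorial_self]
  · obtain ⟨j, hj⟩ := Function.ne_iff.1 h2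
    -- With truncated subtraction, `h1` only says `γ ≤ β`; as `γ j ≠ β j`, the falling factorial at
    -- `j` vanishes.
    have hsub := congrFun h1 j
    simp only [List.mem_finRange, if_true, Pi.zero_apply] at hsub
    have hlt : γ j < β j := by omega
    rw [mul_one]
    push_cast
    exact Finset.prod_eq_zero (Finset.mem_univ j)
      (by exact_mod_cast Nat.descFactorial_eq_zero_iff_lt.2 hlt)
  · exact absurd (_root_.funext fun i => by simp [h2]) h1
  · simp

/-- Two functionals agreeing on all monomials `(x - ξ)^γ` are equal. -/
lemma dual_ext_shiftedMonomial {φ ψ : Module.Dual ℂ (MvPolynomial (Fin n) ℂ)}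
    (h : ∀ γ : Fin n →₀ ℕ, φ (shiftedMonomial ξ γ) = ψ (shiftedMonomial ξ γ)) : φ = ψ := by
  let τ : MvPolynomial (Fin n) ℂ →ₐ[ℂ] MvPolynomial (Fin n) ℂ := aeval fun i => X i - C (ξ i)
  let τ' : MvPolynomial (Fin n) ℂ →ₐ[ℂ] MvPolynomial (Fin n) ℂ := aeval fun i => X i + C (ξ i)
  have hinv : τ.comp τ' = AlgHom.id ℂ _ := by
    ext i
    simp [τ, τ', algHom_C, ← algebraMap_eq]
  have hmon : ∀ γ : Fin n →₀ ℕ, τ (monomial γ 1) = shiftedMonomial ξ γ := fun γ => by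
    rw [aeval_monomial, map_one, one_mul, Finsupp.prod_fintype _ _ (by simp), shiftedMonomial]
  have hcomp : φ ∘ₗ τ.toLinearMap = ψ ∘ₗ τ.toLinearMap := by
    refine (basisMonomials (Fin n) ℂ).ext fun γ => ?_
    simp [hmon, h]
  refine LinearMap.ext fun p => ?_
  have hp : τ (τ' p) = p := DFunLike.congr_fun hinv p
  have := DFunLike.congr_fun hcomp (τ' p)
  simpa [hp] using this

end ShiftedMonomials

/-! ### Duality between the inverse system and powers of the maximal ideal. -/

section InverseSystem

variable {K : Type*} [Field K] [Algebra K ℂ] {ι : Type*} {n : ℕ}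
  {f : ι → MvPolynomial (Fin n) K} {ξ : Fin n → ℂ}

lemma diffEval_apply (Λ p : MvPolynomial (Fin n) ℂ) :
    diffEval ξ Λ p = ∑ β ∈ Λ.support, coeff β Λ * eval ξ (iterPderiv β p) := by
  rw [diffEval, Module.Basis.constr_apply, Finsupp.sum, LinearMap.sum_apply]
  rfl

lemma diffEval_shiftedMonomial (Λ : MvPolynomial (Fin n) ℂ) (γ : Fin n →₀ ℕ) :
    diffEval ξ Λ (shiftedMonomial ξ γ) = coeff γ Λ * ∏ i, ((γ i).factorial : ℂ) := by
  rw [diffEval_apply, Finset.sum_eq_single γ]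
  · rw [eval_iterPderiv_shiftedMonomial, if_pos rfl]
  · intro β _ hβ
    rw [eval_iterPderiv_shiftedMonomial, if_neg, mul_zero]
    exact fun h => hβ (DFunLike.coe_injective h).symm
  · intro h
    rw [notMem_support_iff.1 h, zero_mul]

lemma prod_factorial_ne_zero (γ : Fin n → ℕ) : ∏ i, ((γ i).factorial : ℂ) ≠ 0 :=
  Finset.prod_ne_zero_iff.2 fun i _ => by exact_mod_cast (γ i).factorial_ne_zero

lemma list_prod_pderiv_mem_pow (β : Fin n → ℕ) (l : List (Fin n)) {k : ℕ}
    {p : MvPolynomial (Fin n) ℂ} (hp : p ∈ pointIdeal ξ ^ (k + (l.map β).sum)) :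
    (l.map fun j => ((pderiv j).toLinearMap :
      Module.End ℂ (MvPolynomial (Fin n) ℂ)) ^ β j).prod p ∈ pointIdeal ξ ^ k := by
  have hpow : ∀ (j : Fin n) (b k : ℕ) {p : MvPolynomial (Fin n) ℂ},
      p ∈ pointIdeal ξ ^ (k + b) → (((pderiv j).toLinearMap :
        Module.End ℂ (MvPolynomial (Fin n) ℂ)) ^ b) p ∈ pointIdeal ξ ^ k := by
    intro j b
    induction b with
    | zero => intro k p hp; simpa using hp
    | succ b ih =>
      intro k p hp
      rw [pow_succ', Module.End.mul_apply]
      refine derivation_mem_pow (pderiv j) k (ih (k + 1) ?_)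
      rwa [add_assoc, add_comm 1]
  induction l generalizing k with
  | nil => simpa using hp
  | cons j l ih =>
    rw [List.map_cons, List.prod_cons, Module.End.mul_apply]
    refine hpow j _ _ (ih ?_)
    rwa [add_assoc, ← List.sum_cons, ← List.map_cons]

/-- A differential functional of order at most `t` vanishes on the power `t + 1` of the maximal
ideal. -/
lemma diffEval_eq_zero_of_mem_pow {Λ p : MvPolynomial (Fin n) ℂ} {t : ℕ}
    (hΛ : Λ.totalDegree ≤ t) (hp : p ∈ pointIdeal ξ ^ (t + 1)) : diffEval ξ Λ p = 0 := by
  rw [diffEval_apply]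
  refine Finset.sum_eq_zero fun β hβ => ?_
  have hdeg : ((List.finRange n).map β).sum ≤ t := by
    rw [← List.ofFn_eq_map, List.sum_ofFn, ← Finsupp.sum_fintype β (fun _ e => e) (by simp)]
    exact (le_totalDegree hβ).trans hΛ
  have hmem : iterPderiv β p ∈ pointIdeal ξ ^ 1 := by
    rw [iterPderiv, List.ofFn_eq_map]
    exact list_prod_pderiv_mem_pow β _ (Ideal.pow_le_pow_right (by omega) hp)
  rw [pow_one] at hmem
  rw [mem_pointIdeal.1 hmem, mul_zero]

lemma mem_inverseSystem {Λ : MvPolynomial (Fin n) ℂ} :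
    Λ ∈ inverseSystem f ξ ↔ ∀ p ∈ systemIdeal f, diffEval ξ Λ p = 0 := by
  rw [inverseSystem, Submodule.mem_comap, Submodule.mem_dualAnnihilator]
  rfl

/-- Differential functionals cannot distinguish an ideal from its primary component. -/
lemma diffEval_eq_zero_of_mem_primaryComponent {Λ p : MvPolynomial (Fin n) ℂ}
    (hΛ : Λ ∈ inverseSystem f ξ) (hp : p ∈ primaryComponent (systemIdeal f) ξ) :
    diffEval ξ Λ p = 0 := by
  obtain ⟨g, hg, hgp⟩ := hp
  obtain ⟨h, hh⟩ := exists_one_sub_mul_mem_pow hg (Λ.totalDegree + 1)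
  -- The first summand is killed by the order bound, the second because it lies in the ideal.
  have e : p = (1 - h * g) * p + h * (g * p) := by ring
  rw [e, map_add, diffEval_eq_zero_of_mem_pow le_rfl (Ideal.mul_mem_right _ _ hh),
    mem_inverseSystem.1 hΛ _ (Ideal.mul_mem_left _ _ hgp), add_zero]

/-- A functional vanishing on the power `t + 1` of the maximal ideal is differential of order at
most `t`. -/
lemma exists_diffEval_eq {φ : Module.Dual ℂ (MvPolynomial (Fin n) ℂ)} {t : ℕ}
    (hφ : ∀ p ∈ pointIdeal ξ ^ (t + 1), φ p = 0) :
    ∃ Λ : MvPolynomial (Fin n) ℂ, Λ.totalDegree ≤ t ∧ diffEval ξ Λ = φ := by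
  -- Monomials of degree above `t` are killed by `φ`, so its Taylor-type expansion is a polynomial
  -- in the `∂_j`.
  have hfin : {γ : Fin n →₀ ℕ | φ (shiftedMonomial ξ γ) ≠ 0}.Finite := by
    refine (Finsupp.finite_of_degree_le t).subset fun γ hγ => ?_
    by_contra hlt
    refine hγ (hφ _ (Ideal.pow_le_pow_right ?_ (shiftedMonomial_mem_pow _)))
    rw [Set.mem_ofPred_eq, Finsupp.degree_eq_sum] at hlt
    omega
  let Λ : MvPolynomial (Fin n) ℂ := ∑ γ ∈ hfin.toFinset,
    monomial γ (φ (shiftedMonomial ξ γ) / ∏ i, ((γ i).factorial : ℂ))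
  have hcoeff : ∀ γ, coeff γ Λ = φ (shiftedMonomial ξ γ) / ∏ i, ((γ i).factorial : ℂ) := by
    intro γ
    simp only [Λ, coeff_sum, coeff_monomial, Finset.sum_ite_eq', Set.Finite.mem_toFinset,
      Set.mem_ofPred_eq]
    split_ifs with h
    · rfl
    · rw [not_not.1 h, zero_div]
  refine ⟨Λ, ?_, dual_ext_shiftedMonomial (ξ := ξ) fun γ => ?_⟩
  · refine Finset.sup_le fun γ hγ => ?_
    by_contra hlt
    refine mem_support_iff.1 hγ ?_
    rw [hcoeff, hφ _ (Ideal.pow_le_pow_right ?_ (shiftedMonomial_mem_pow _)), zero_div]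
    rw [Finsupp.sum_fintype _ _ (by simp)] at hlt
    omega
  · rw [diffEval_shiftedMonomial, hcoeff, div_mul_cancel₀ _ (prod_factorial_ne_zero γ)]

lemma inverseSystemLE_succ_eq_of_pow_le {t : ℕ}
    (h : pointIdeal ξ ^ (t + 1) ≤ primaryComponent (systemIdeal f) ξ) :
    inverseSystemLE f ξ (t + 1) = inverseSystemLE f ξ t := by
  ext Λ
  simp only [inverseSystemLE, Submodule.mem_inf, mem_restrictTotalDegree]
  refine ⟨fun ⟨hΛ, _⟩ => ⟨hΛ, ?_⟩, fun ⟨hΛ, ht⟩ => ⟨hΛ, ht.trans t.le_succ⟩⟩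
  refine Finset.sup_le fun γ hγ => ?_
  by_contra hlt
  have h0 := diffEval_eq_zero_of_mem_primaryComponent hΛ
    (h (Ideal.pow_le_pow_right (by rw [Finsupp.sum_fintype _ _ (by simp)] at hlt; omega)
      (shiftedMonomial_mem_pow γ)))
  rw [diffEval_shiftedMonomial] at h0
  exact mem_support_iff.1 hγ ((mul_eq_zero.1 h0).resolve_right (prod_factorial_ne_zero γ))

/-- A Nakayama argument: multiplying the inclusion by `m ^ k` pushes the error term into ever higher
powers, finally into `Q`. -/
lemma pow_le_of_pow_le_sup {m Q : Ideal (MvPolynomial (Fin n) ℂ)} {M t : ℕ} (hM : m ^ M ≤ Q)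
    (h : m ^ t ≤ Q ⊔ m ^ (t + 1)) : m ^ t ≤ Q := by
  have key : ∀ k, m ^ t ≤ Q ⊔ m ^ (t + k) := by
    intro k
    induction k with
    | zero => exact le_sup_right
    | succ k ih =>
      refine ih.trans (sup_le le_sup_left ?_)
      calc m ^ (t + k) = m ^ k * m ^ t := by rw [← pow_add, add_comm]
        _ ≤ m ^ k * (Q ⊔ m ^ (t + 1)) := Ideal.mul_mono_right h
        _ = m ^ k * Q ⊔ m ^ k * m ^ (t + 1) := Ideal.mul_sup _ _ _
        _ ≤ Q ⊔ m ^ (t + (k + 1)) := by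
          refine sup_le_sup Ideal.mul_le_right ?_
          rw [← pow_add, show k + (t + 1) = t + (k + 1) by ring]
  exact (key M).trans (sup_le le_rfl ((Ideal.pow_le_pow_right (by omega)).trans hM))

lemma pow_le_of_inverseSystemLE_succ_eq {M t : ℕ}
    (hM : pointIdeal ξ ^ M ≤ primaryComponent (systemIdeal f) ξ)
    (h : inverseSystemLE f ξ (t + 1) = inverseSystemLE f ξ t) :
    pointIdeal ξ ^ (t + 1) ≤ primaryComponent (systemIdeal f) ξ := by
  refine pow_le_of_pow_le_sup hM fun p hp => ?_
  set W := primaryComponent (systemIdeal f) ξ ⊔ pointIdeal ξ ^ (t + 1 + 1) with hW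
  by_contra hpW
  -- A functional separating `p` from `W` is an operator of order at most `t + 1` in the inverse
  -- system; by `h` its order is at most `t`, so it kills `p`.
  obtain ⟨φ, hφp, hφ⟩ := Submodule.exists_le_ker_of_notMem (p := W.restrictScalars ℂ) hpW
  obtain ⟨Λ, hdeg, rfl⟩ := exists_diffEval_eq (ξ := ξ) (t := t + 1) (φ := φ) fun q hq =>
    hφ (show q ∈ W from Ideal.mem_sup_right hq)
  have hΛ : Λ ∈ inverseSystemLE f ξ (t + 1) := by
    refine Submodule.mem_inf.2 ⟨mem_inverseSystem.2 fun q hq => ?_,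
      (mem_restrictTotalDegree _ _ _).2 hdeg⟩
    exact hφ (show q ∈ W from Ideal.mem_sup_left (le_primaryComponent _ hq))
  rw [h] at hΛ
  exact hφp (diffEval_eq_zero_of_mem_pow
    ((mem_restrictTotalDegree _ _ _).1 (Submodule.mem_inf.1 hΛ).2) hp)

lemma nilIndex_le_of_pow_le {t : ℕ}
    (h : pointIdeal ξ ^ (t + 1) ≤ primaryComponent (systemIdeal f) ξ) : nilIndex f ξ ≤ t :=
  Nat.sInf_le (inverseSystemLE_succ_eq_of_pow_le h)

lemma IsIsolatedRoot.pow_nilIndex_succ_le (h : IsIsolatedRoot f ξ) :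
    pointIdeal ξ ^ (nilIndex f ξ + 1) ≤ primaryComponent (systemIdeal f) ξ := by
  obtain ⟨M, hM⟩ := h.exists_pow_le
  refine pow_le_of_inverseSystemLE_succ_eq hM ?_
  -- Needed because `sInf ∅ = 0` would carry no information.
  have hne : {t | inverseSystemLE f ξ (t + 1) = inverseSystemLE f ξ t}.Nonempty :=
    ⟨M, inverseSystemLE_succ_eq_of_pow_le ((Ideal.pow_le_pow_right M.le_succ).trans hM)⟩
  exact Nat.sInf_mem hne

end InverseSystem

/-! ### The operators `Λ_i`: kernel vectors of the Jacobian and derivations. -/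

section KernelMatrix

open Matrix

lemma det_ne_zero_of_rank_eq {r : ℕ} {A : Matrix (Fin r) (Fin r) ℂ} (h : A.rank = r) :
    A.det ≠ 0 := by
  rw [← isUnit_iff_ne_zero, ← Matrix.isUnit_iff_isUnit_det, ← mulVec_surjective_iff_isUnit]
  have htop : LinearMap.range A.mulVecLin = ⊤ := Submodule.eq_top_of_finrank_eq ?_
  · exact LinearMap.range_eq_top.1 htop
  rw [Module.finrank_fin_fun]
  exact h

/-- If the upper left block of a block matrix is square and has the rank of the whole matrix, then
the kernel is cut out by the upper rows. -/
lemma mulVec_eq_zero_of_toRows₁ {r s c : ℕ} {M : Matrix (Fin r ⊕ Fin s) (Fin r ⊕ Fin c) ℂ}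
    (hM : M.rank = r) (hA : M.toBlocks₁₁.rank = r) {v : Fin r ⊕ Fin c → ℂ}
    (hv : M.toRows₁ *ᵥ v = 0) : M *ᵥ v = 0 := by
  have hrow : M.toRows₁.rank = r :=
    le_antisymm ((rank_le_card_height _).trans (Fintype.card_fin r).le)
      (hA.symm.le.trans (rank_submatrix_le M.toRows₁ id Sum.inl))
  have hle : LinearMap.ker M.mulVecLin ≤ LinearMap.ker M.toRows₁.mulVecLin := by
    intro w hw
    rw [LinearMap.mem_ker, mulVecLin_apply] at hw ⊢
    exact _root_.funext fun i => congrFun hw (Sum.inl i)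
  have h1 := LinearMap.finrank_range_add_finrank_ker M.mulVecLin
  have h2 := LinearMap.finrank_range_add_finrank_ker M.toRows₁.mulVecLin
  rw [Matrix.rank] at hM hrow
  -- Equal ranks give kernels of equal dimension by rank-nullity.
  have heq := Submodule.eq_of_le_of_finrank_eq hle (by omega)
  have hmem : v ∈ LinearMap.ker M.toRows₁.mulVecLin := hv
  rw [← heq] at hmem
  exact hmem

variable {K : Type*} [Field K] {ι : Type*} {n r s c : ℕ}
  {f : ι → MvPolynomial (Fin n) K}
  {rows : Fin r ⊕ Fin s ≃ ι} {cols : Fin r ⊕ Fin c ≃ Fin n}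

/-- A polynomial identity, from `A * adj A = det A`; the lower rows annihilate the columns only at
`ξ`, by the rank condition. -/
lemma toRows₁_mul_kernelMatrix :
    ((jacobian f).submatrix rows cols).toRows₁ * kernelMatrix f rows cols = 0 := by
  have h : ((jacobian f).submatrix rows cols).toRows₁ =
      fromCols (blockA f rows cols) (blockB f rows cols) := by
    ext i (j | j) <;> rfl
  rw [h, kernelMatrix, fromCols_mul_fromRows, Matrix.mul_neg, ← Matrix.mul_assoc, mul_adjugate,
    Matrix.mul_smul, Matrix.mul_one, Matrix.smul_mul, Matrix.one_mul, neg_add_cancel]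

variable [Algebra K ℂ] {ξ : Fin n → ℂ}

lemma aeval_formalDifferential_eq_zero
    (hr : (evalMatrix ξ (jacobian f)).rank = r)
    (hA : (evalMatrix ξ (blockA f rows cols)).rank = r) (i : Fin c) (k : ι) :
    aeval ξ (formalDifferential f rows cols i (f k)) = 0 := by
  set M := evalMatrix ξ ((jacobian f).submatrix rows cols) with hMdef
  have hM : M.rank = r := (rank_submatrix (evalMatrix ξ (jacobian f)) rows cols).trans hr
  have hv : M.toRows₁ *ᵥ (fun j => aeval ξ (kernelMatrix f rows cols j i)) = 0 := by
    refine _root_.funext fun l => ?_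
    have h := congrArg (aeval ξ) (congrFun (congrFun
      (toRows₁_mul_kernelMatrix (f := f) (rows := rows) (cols := cols)) l) i)
    rw [Matrix.mul_apply, map_sum, Matrix.zero_apply, map_zero] at h
    simp only [map_mul] at h
    exact h
  have h := congrFun (mulVec_eq_zero_of_toRows₁ hM hA hv) (rows.symm k)
  rw [formalDifferential, map_sum, ← Equiv.sum_comp cols]
  refine Eq.trans (Finset.sum_congr rfl fun j _ => ?_) h
  simp [hMdef, evalMatrix, jacobian, mul_comm]

lemma IsIsolatedRoot.deflatedSystem (h : IsIsolatedRoot f ξ)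
    (hr : (evalMatrix ξ (jacobian f)).rank = r)
    (hA : (evalMatrix ξ (blockA f rows cols)).rank = r) (S : Finset (Fin c)) :
    IsIsolatedRoot (deflatedSystem f rows cols S) ξ := by
  obtain ⟨hroot, g, hg, hiso⟩ := h
  refine ⟨?_, g, hg, fun x hx => hiso x fun k => hx (Sum.inl k)⟩
  rintro (k | q)
  · exact hroot k
  · exact aeval_formalDifferential_eq_zero hr hA _ _

variable (f rows cols) in
/-- The formal differential `Λ_i` as a derivation of `ℂ[x₁, …, xₙ]`. -/
noncomputable def formalDerivation (i : Fin c) :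
    Derivation ℂ (MvPolynomial (Fin n) ℂ) (MvPolynomial (Fin n) ℂ) :=
  ∑ j : Fin n, MvPolynomial.map (algebraMap K ℂ) (kernelMatrix f rows cols (cols.symm j) i) •
    pderiv j

lemma formalDerivation_apply (i : Fin c) (p : MvPolynomial (Fin n) ℂ) :
    formalDerivation f rows cols i p =
      ∑ j : Fin n, MvPolynomial.map (algebraMap K ℂ) (kernelMatrix f rows cols (cols.symm j) i) *
        pderiv j p := by
  rw [formalDerivation, ← Derivation.coeFnAddMonoidHom_apply, map_sum, Finset.sum_apply]
  rfl

lemma formalDerivation_map (i : Fin c) (p : MvPolynomial (Fin n) K) :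
    formalDerivation f rows cols i (MvPolynomial.map (algebraMap K ℂ) p) =
      MvPolynomial.map (algebraMap K ℂ) (formalDifferential f rows cols i p) := by
  simp [formalDerivation_apply, formalDifferential, pderiv_map]

/-- The identity block gives `Λ_i` the coefficient `det A` on its own free variable, and this
coordinate is the transversal one. -/
lemma eval_formalDerivation_ne_zero
    (hA : (evalMatrix ξ (blockA f rows cols)).rank = r) (i : Fin c) :
    eval ξ (formalDerivation f rows cols i
      (X (cols (Sum.inr i)) - C (ξ (cols (Sum.inr i))))) ≠ 0 := by
  have hdet : aeval ξ (blockA f rows cols).det ≠ 0 := by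
    have := det_ne_zero_of_rank_eq hA
    rwa [evalMatrix, ← AlgHom.mapMatrix_apply, ← AlgHom.map_det] at this
  rw [formalDerivation_apply, Finset.sum_eq_single (cols (Sum.inr i))]
  · simpa [kernelMatrix, eval_map, ← aeval_def] using hdet
  · intro j _ hj
    simp [pderiv_X_of_ne hj.symm]
  · simp

lemma systemIdeal_le_deflatedSystem (S : Finset (Fin c)) :
    systemIdeal f ≤ systemIdeal (deflatedSystem f rows cols S) := by
  refine Ideal.span_mono ?_
  rintro _ ⟨k, rfl⟩
  exact ⟨Sum.inl k, rfl⟩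

lemma formalDerivation_mem {S : Finset (Fin c)} {i : Fin c} (hi : i ∈ S)
    {p : MvPolynomial (Fin n) ℂ} (hp : p ∈ systemIdeal f) :
    formalDerivation f rows cols i p ∈ systemIdeal (deflatedSystem f rows cols S) := by
  refine derivation_mem_of_span _ (systemIdeal_le_deflatedSystem S) ?_ hp
  rintro _ ⟨k, rfl⟩
  rw [formalDerivation_map]
  exact Ideal.subset_span ⟨Sum.inr (⟨i, hi⟩, k), rfl⟩

lemma IsIsolatedRoot.one_le_multiplicity (h : IsIsolatedRoot f ξ) : 1 ≤ multiplicity f ξ := by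
  obtain ⟨M, hM⟩ := h.exists_pow_le
  have := finite_quotient_of_pow_le hM
  have hne : primaryComponent (systemIdeal f) ξ ≠ ⊤ := fun htop => by
    have h1 := mem_pointIdeal.1 (primaryComponent_le_pointIdeal h.1.systemIdeal_le
      ((Ideal.eq_top_iff_one _).1 htop))
    simp at h1
  have := Ideal.Quotient.nontrivial_iff.2 hne
  exact Module.finrank_pos

end KernelMatrix

end Deflation

/-! ### The deflation theorem. -/

theorem mainTheorem4 (K : Subfield ℂ) (n N r s c : ℕ)
    (f : Fin N → MvPolynomial (Fin n) K) (ξ : Fin n → ℂ)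
    (hξ : Deflation.IsIsolatedRoot f ξ)
    (hr : (Deflation.evalMatrix ξ (Deflation.jacobian f)).rank = r) (hrn : r < n)
    (rows : Fin r ⊕ Fin s ≃ Fin N) (cols : Fin r ⊕ Fin c ≃ Fin n)
    (hA : (Deflation.evalMatrix ξ (Deflation.blockA f rows cols)).rank = r)
    (S : Finset (Fin c)) (hS : S.Nonempty) :
    Deflation.IsIsolatedRoot (Deflation.deflatedSystem f rows cols S) ξ ∧
      1 ≤ Deflation.multiplicity (Deflation.deflatedSystem f rows cols S) ξ ∧
      Deflation.nilIndex (Deflation.deflatedSystem f rows cols S) ξ < Deflation.nilIndex f ξ ∧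
      Deflation.multiplicity (Deflation.deflatedSystem f rows cols S) ξ <
        Deflation.multiplicity f ξ := by
  open Deflation in
  have hdef := hξ.deflatedSystem hr hA S
  obtain ⟨i, hi⟩ := hS
  obtain ⟨M, hM⟩ := hξ.exists_pow_le
  have hfin := finite_quotient_of_pow_le hM
  have hle : systemIdeal f ≤ systemIdeal (deflatedSystem f rows cols S) :=
    systemIdeal_le_deflatedSystem S
  have hl := X_sub_C_mem_pointIdeal (ξ := ξ) (cols (Sum.inr i))
  have hDl := eval_formalDerivation_ne_zero hA i
  have hD := fun p (hp : p ∈ systemIdeal f) =>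
    formalDerivation_mem (rows := rows) (cols := cols) hi hp
  refine ⟨hdef, hdef.one_le_multiplicity, ?_,
    finrank_quotient_lt (primaryComponent_lt_of_derivation hle hD hξ.1.systemIdeal_le hl hDl hM)⟩
  have hpow := pointIdeal_pow_le_of_derivation hle hD hl hDl hξ.pow_nilIndex_succ_le
  cases ho : nilIndex f ξ with
  -- Nil-index zero would put `1` in the deflated primary component, although `ξ` is a root of the
  -- deflated system.
  | zero =>
    rw [ho, pow_zero, Ideal.one_eq_top] at hpow
    have h1 := mem_pointIdeal.1 (primaryComponent_le_pointIdeal hdef.1.systemIdeal_le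
      (hpow (Submodule.mem_top (x := 1))))
    simp at h1
  | succ o =>
    rw [ho] at hpow
    exact Nat.lt_succ_of_le (nilIndex_le_of_pow_le hpow)
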